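/- Let $M_p(\mathbb{R})$ be the space of point measures on $\mathbb{R}$ that are finite on bounded sets. Let $(\xi'_i,X'_i)$, $i\ge 0$, be independent random elements of $M_p(\mathbb{R})\times[0,\infty)$ such that the pairs $(\xi'_i,X'_i)$, $i\ge 1$, are identically distributed; $\xi'_i$ and $X'_i$ may depend on each other, and $(\xi'_0,X'_0)$ may have a different law. Suppose that $X'_1$ has finite mean $\mu=\mathbb{E}X'_1>0$ and that its law is nonarithmetic, i.e. not concentrated on $h\mathbb{Z}$ for any $h>0$. Put $T'_i=\sum_{j=0}^{i}X'_j$ for $i\ge 0$, and define the renewal cluster point process $$\xi'(B)=\sum_{i\ge 0}\xi'_i(B-T'_i),\qquad B\subseteq\mathbb{R}\text{ Borel},$$ where it is assumed that almost surely $\xi'(B)<\infty$ for all bounded Borel sets $B$. Let $L'_i=\xi'_i(\mathbb{R})$ be the number of points of $\xi'_i$, counted with multiplicity, and assume that $L'_i<\infty$ almost surely for every $i$. Let $R'_i=\sup\{|y| : \xi'_i(\{y\})>0\}$, with $R'_i=0$ if $\xi'_i$ has no points; thus if $\xi'_i=\sum_{j=1}^{L'_i}\delta_{T'_{ij}}$,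 then $R'_i=\sup_{j\le L'_i}|T'_{ij}|$. Assume that $L'_0$, $L'_1$, $L'_1X'_1$ and $L'_1R'_1$ all have finite mean. Then for every $x>0$ $$\mathbb{E}\,\xi'\big((t,t+x]\big)\longrightarrow \frac{\mathbb{E}L'_1}{\mu}\,x\qquad\text{as } t\to\infty .$$ -/

import Mathlib

open MeasureTheory ProbabilityTheory Filter Topology Set
open scoped NNReal ENNReal

/-- A point measure on `ℝ`: it takes finite, nonnegative integer values on bounded Borel sets. -/
def IsPointMeasure (m : Measure ℝ) : Prop :=
  ∀ B : Set ℝ, MeasurableSet B → Bornology.IsBounded B → ∃ n : ℕ, m B = n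

/-- The space `M_p(ℝ)` of point measures on `ℝ` that are finite on bounded sets. As a subtype of
`Measure ℝ` it carries the σ-algebra generated by the evaluations `m ↦ m B`, `B` Borel. -/
abbrev PointMeasure : Type := {m : Measure ℝ // IsPointMeasure m}

/-- The number of points (with multiplicity) of a point measure; for `m = ∑_{j=1}^L δ_{T_j}`
this is `L`. -/
noncomputable def clusterSize (m : PointMeasure) : ℝ≥0∞ := (m : Measure ℝ) univ

/-- The largest absolute value of a point of `m`; for `m = ∑_{j=1}^L δ_{T_j}` this is
`sup_{j ≤ L} |T_j|`, which is `0` if `m` has no points. -/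
noncomputable def clusterRadius (m : PointMeasure) : ℝ≥0∞ :=
  ⨆ (y : ℝ) (_ : (m : Measure ℝ) {y} ≠ 0), ENNReal.ofReal |y|

/-- A law on `ℝ` is nonarithmetic if it is not concentrated on any lattice `h ℤ`, `h > 0`. -/
def IsNonarithmetic (ν : Measure ℝ) : Prop :=
  ∀ h : ℝ, 0 < h → ¬ ∀ᵐ y ∂ν, ∃ k : ℤ, y = h * k

/-- The points `T'_i = X'_0 + ⋯ + X'_i` of the parent process. -/
noncomputable def parentPoint {Ω : Type*} (X : ℕ → Ω → ℝ≥0) (i : ℕ) (ω : Ω) : ℝ :=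
  ∑ j ∈ Finset.range (i + 1), (X j ω : ℝ)

/-- The renewal cluster process `ξ'(B) = ∑_{i ≥ 0} ξ'_i(B - T'_i)`: the `i`-th cluster is
translated by `T'_i`, and all the translated clusters are superposed. -/
noncomputable def renewalCluster {Ω : Type*} (ξ : ℕ → Ω → PointMeasure) (X : ℕ → Ω → ℝ≥0)
    (ω : Ω) : Measure ℝ :=
  Measure.sum fun i => (ξ i ω : Measure ℝ).map (fun y => parentPoint X i ω + y)

/-! Write `F` for the law of `X 1`, `F₀` for that of `X 0`, `U = ∑ₙ F^{*n}` for the renewal measure,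
and `ν₀`, `ν` for the intensities of the clusters with index 0 and 1, each translated by its own
step. Cluster `i + 1` is translated by its own step plus the preceding parent point, which is
independent of it and has law `F₀ ∗ F^{*i}`. The possible dependence between a cluster and its step
is thus absorbed into `ν`, and the mean measure of the process is `ν₀ + ν ∗ F₀ ∗ U`
(`lintegral_renewalCluster`). The finite measure `ν₀` has no mass left at infinity. The measure `ν ∗
F₀` has total mass `E L'_1`, so Blackwell's theorem for `U` gives the limit by dominated
convergence, because the `U`-mass of windows of fixed length is bounded.

Blackwell's theorem (`tendsto_renewalMeasure_Ioc`) is proved by smoothing. For a continuous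
compactly supported `g ≥ 0`, the function `Z = g ∗ U` is bounded, uniformly continuous and satisfies
`Z = g + F ∗ Z`. A Choquet–Deny type argument (`tendsto_add_sub_of_renewal`) makes `Z (t - s) - Z t`
tend to 0. Since `U` convolved with the tail measure `P(X > s) ds` is Lebesgue measure on the
half-line, averaging `Z (t - s)` against that tail gives exactly `∫ g` for large `t`. The tail has
mass `μ`, hence `μ Z(t) → ∫ g`. Squeezing an interval between such functions `g` finishes the proof.
-/

/-! ### Asymptotic density of the monoid generated by the support. -/

/-- Every element of the group generated by a submonoid of `ℝ` is a difference of two elements of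
the submonoid. -/
lemma AddSubmonoid.exists_sub_of_mem_closure (S : AddSubmonoid ℝ) {x : ℝ}
    (hx : x ∈ AddSubgroup.closure (S : Set ℝ)) : ∃ a ∈ S, ∃ b ∈ S, x = b - a := by
  induction hx using AddSubgroup.closure_induction with
  | mem x hx => exact ⟨0, S.zero_mem, x, hx, by simp⟩
  | zero => exact ⟨0, S.zero_mem, 0, S.zero_mem, by simp⟩
  | add x y _ _ hx hy =>
    obtain ⟨a, ha, b, hb, rfl⟩ := hx
    obtain ⟨c, hc, d, hd, rfl⟩ := hy
    exact ⟨a + c, S.add_mem ha hc, b + d, S.add_mem hb hd, by ring⟩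
  | neg x _ hx =>
    obtain ⟨a, ha, b, hb, rfl⟩ := hx
    exact ⟨b, hb, a, ha, by ring⟩

/-- A submonoid of `[0, ∞)` that generates a dense subgroup of `ℝ` is asymptotically dense. -/
lemma AddSubmonoid.eventually_exists_abs_sub_lt (S : AddSubmonoid ℝ) (hS : ∀ a ∈ S, 0 ≤ a)
    (hd : Dense (AddSubgroup.closure (S : Set ℝ) : Set ℝ)) {ε : ℝ} (hε : 0 < ε) :
    ∀ᶠ y in atTop, ∃ a ∈ S, |y - a| < ε := by
  obtain ⟨x, hx, hx0, hxε⟩ := hd.exists_between hε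
  obtain ⟨a, ha, b, hb, rfl⟩ := S.exists_sub_of_mem_closure hx
  have ha0 := hS a ha
  set c := a + b with hc
  set d := b - a with hd
  have hc0 : 0 < c := by linarith
  -- Exchanging `k` of the `n` summands `a + b` of `n * c` for `b + b` gives the element `n * c + k
  -- * d` of `S`, for every `k ≤ n`. Once `n * d ≥ c`, these points, spaced by `d < ε`, reach across
  -- the whole interval from `n * c` to `(n + 1) * c`.
  obtain ⟨N, hN⟩ := exists_nat_ge (c / d)
  rw [div_le_iff₀ hx0] at hN
  filter_upwards [eventually_ge_atTop (N * c)] with y hy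
  have hy0 : 0 ≤ y := le_trans (by positivity) hy
  set n := ⌊y / c⌋₊ with hn
  have hn1 : n * c ≤ y := by
    have := Nat.floor_le (div_nonneg hy0 hc0.le)
    rwa [le_div_iff₀ hc0] at this
  have hn2 : y < (n + 1) * c := by
    have := Nat.lt_floor_add_one (y / c)
    rwa [div_lt_iff₀ hc0] at this
  have hNn : N ≤ n := Nat.le_floor (by rwa [le_div_iff₀ hc0])
  have hNn' : (N : ℝ) ≤ n := by exact_mod_cast hNn
  set k := ⌊(y - n * c) / d⌋₊ with hk
  have hk1 : k * d ≤ y - n * c := by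
    have := Nat.floor_le (div_nonneg (sub_nonneg.2 hn1) hx0.le)
    rwa [le_div_iff₀ hx0] at this
  have hk2 : y - n * c < (k + 1) * d := by
    have := Nat.lt_floor_add_one ((y - n * c) / d)
    rwa [div_lt_iff₀ hx0] at this
  have hkn : k ≤ n := by
    have h1 : (k : ℝ) * d ≤ n * d := by nlinarith
    exact_mod_cast le_of_mul_le_mul_right h1 hx0
  refine ⟨(n - k) • c + k • (b + b), S.add_mem (S.nsmul_mem (S.add_mem ha hb) _)
    (S.nsmul_mem (S.add_mem hb hb) _), ?_⟩
  have : (n - k) • c + k • (b + b) = n * c + k * d := by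
    simp only [nsmul_eq_mul, Nat.cast_sub hkn, hc, hd]; ring
  rw [this, abs_lt]
  constructor <;> nlinarith

/-- The group generated by the support of a nonarithmetic law is dense. -/
lemma IsNonarithmetic.dense_closure_support {F : Measure ℝ} (hF : IsNonarithmetic F) :
    Dense (AddSubgroup.closure F.support : Set ℝ) := by
  refine (AddSubgroup.dense_or_cyclic _).resolve_right ?_
  rintro ⟨a, ha⟩
  have key : ∀ᵐ y ∂F, ∃ k : ℤ, y = a * k := by
    filter_upwards [Measure.support_mem_ae (μ := F)] with y hy
    have : y ∈ AddSubgroup.closure F.support := AddSubgroup.subset_closure hy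
    rw [ha, AddSubgroup.mem_closure_singleton] at this
    obtain ⟨k, rfl⟩ := this
    exact ⟨k, by simp [mul_comm]⟩
  rcases lt_trichotomy a 0 with h | rfl | h
  · refine hF (-a) (by linarith) ?_
    filter_upwards [key] with y ⟨k, hk⟩
    exact ⟨-k, by simp [hk]⟩
  · refine hF 1 one_pos ?_
    filter_upwards [key] with y ⟨k, hk⟩
    exact ⟨0, by simp [hk]⟩
  · exact hF a h key

/-- For a nonarithmetic law on `[0, ∞)`, the additive monoid generated by the support is
asymptotically dense. -/
lemma IsNonarithmetic.eventually_exists_mem_closure_support {F : Measure ℝ}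
    (hF : IsNonarithmetic F) (hF0 : F (Iio 0) = 0) {ε : ℝ} (hε : 0 < ε) :
    ∀ᶠ y in atTop, ∃ a ∈ AddSubmonoid.closure F.support, |y - a| < ε := by
  refine AddSubmonoid.eventually_exists_abs_sub_lt _ (fun a ha => ?_) ?_ hε
  · have h : F.support ⊆ Ici 0 := Measure.support_subset_of_isClosed isClosed_Ici (by
      rw [mem_ae_iff, compl_Ici, hF0])
    induction ha using AddSubmonoid.closure_induction with
    | mem x hx => exact h hx
    | zero => exact le_rfl
    | add x y _ _ hx hy => exact add_nonneg hx hy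
  · exact hF.dense_closure_support.mono (AddSubgroup.closure_mono AddSubmonoid.subset_closure)

/-! ### Asymptotic translation invariance of solutions of the renewal equation. -/

section Shift

variable {F : Measure ℝ} [IsProbabilityMeasure F]

/-- If `D` asymptotically satisfies `D = F ⋆ D`, and along `l ≤ atTop` it tends to an asymptotic
upper bound `η`, then so do its translates by points of the support of `F`. -/
lemma tendsto_sub_of_mem_support {D : ℝ → ℝ} (hD : UniformContinuous D) {C : ℝ}
    (hC : ∀ t, |D t| ≤ C)
    (hren : Tendsto (fun t => D t - ∫ y, D (t - y) ∂F) atTop (𝓝 0)) {η : ℝ}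
    (hη : ∀ ε > 0, ∀ᶠ t in atTop, D t < η + ε) {l : Filter ℝ} [l.IsCountablyGenerated]
    (hl : l ≤ atTop) {a : ℝ} (hDl : Tendsto (fun t => D (t - a)) l (𝓝 η))
    {s : ℝ} (hs : s ∈ F.support) :
    Tendsto (fun t => D (t - (a + s))) l (𝓝 η) := by
  have hsub : ∀ c : ℝ, Tendsto (fun t : ℝ => t - c) l atTop := fun c =>
    (tendsto_atTop_add_const_right _ (-c) tendsto_id).mono_left hl
  have hint : ∀ t, Integrable (fun y => D (t - y)) F := fun t =>
    Integrable.of_bound (hD.continuous.comp (by fun_prop)).aestronglyMeasurable C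
      (Eventually.of_forall fun y => hC _)
  have hint' : ∀ t, Integrable (fun y => D (t - y) - η) F := fun t =>
    (hint t).sub (integrable_const _)
  -- the positive part of the deviation vanishes
  have hpos : Tendsto (fun t => ∫ y, max (D (t - a - y) - η) 0 ∂F) l (𝓝 0) := by
    have := tendsto_integral_filter_of_dominated_convergence (l := l) (μ := F)
      (F := fun t y => max (D (t - a - y) - η) 0) (f := fun _ => 0) (fun _ => C + |η|)
      (Eventually.of_forall fun t => by
        have := hD.continuous
        exact Continuous.aestronglyMeasurable (by fun_prop))
      (Eventually.of_forall fun t => Eventually.of_forall fun y => by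
        rw [Real.norm_eq_abs, abs_of_nonneg (le_max_right _ _)]
        have h1 := hC (t - a - y)
        have h2 := neg_abs_le η
        have h3 := le_abs_self (D (t - a - y))
        have h4 := abs_nonneg (D (t - a - y))
        exact max_le (by linarith) (by positivity [h4.trans h1]))
      (integrable_const _)
      (Eventually.of_forall fun y => by
        rw [Metric.tendsto_nhds]
        intro ε hε
        have h1 := (hsub (a + y)).eventually (hη ε hε)
        filter_upwards [h1] with t ht
        rw [Real.dist_eq, sub_zero, abs_of_nonneg (le_max_right _ _)]
        rw [← sub_sub] at ht
        exact max_lt (by linarith) hε)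
    simpa using this
  have hdev : Tendsto (fun t => ∫ y, (D (t - a - y) - η) ∂F) l (𝓝 0) := by
    have h1 := hDl.sub (hren.comp (hsub a))
    have h2 := h1.sub_const η
    simp only [sub_zero, sub_self] at h2
    refine h2.congr fun t => ?_
    rw [integral_sub (hint _) (integrable_const _)]
    simp
  -- Here `|v| = 2 * max v 0 - v`: the mean deviation and its positive part both vanish, hence so
  -- does the mean absolute deviation.
  have habs : Tendsto (fun t => ∫ y, |D (t - a - y) - η| ∂F) l (𝓝 0) := by
    have h1 := (hpos.const_mul 2).sub hdev
    simp only [mul_zero, sub_zero] at h1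
    refine h1.congr fun t => ?_
    rw [← integral_const_mul, ← integral_sub]
    · congr 1 with y
      rcases le_total (D (t - a - y) - η) 0 with h | h
      · rw [max_eq_right h, abs_of_nonpos h]; ring
      · rw [max_eq_left h, abs_of_nonneg h]; ring
    · exact ((hint' _).pos_part).const_mul 2
    · exact hint' _
  rw [Metric.tendsto_nhds]
  intro ε hε
  obtain ⟨δ, hδ, hδD⟩ := Metric.uniformContinuous_iff.1 hD (ε / 2) (by positivity)
  have hp : 0 < F.real (Metric.ball s δ) := by
    have := (Measure.mem_support_iff_forall s).1 hs _ (Metric.ball_mem_nhds s hδ)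
    exact ENNReal.toReal_pos this.ne' (measure_ne_top _ _)
  set p := F.real (Metric.ball s δ)
  -- A deviation of at least `ε` at `s` would persist as `ε / 2` on the whole ball by uniform
  -- continuity, and so contribute at least `p * (ε / 2)` to the integral.
  have hev := (Metric.tendsto_nhds.1 habs) (p * (ε / 2)) (by positivity)
  filter_upwards [hev] with t ht
  rw [Real.dist_eq, sub_zero] at ht
  rw [Real.dist_eq]
  by_contra! hcon
  have hle : p * (ε / 2) ≤ ∫ y, |D (t - a - y) - η| ∂F := by
    calc p * (ε / 2) = ∫ y in Metric.ball s δ, (ε / 2) ∂F := by simp [p]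
      _ ≤ ∫ y in Metric.ball s δ, |D (t - a - y) - η| ∂F := by
          refine setIntegral_mono_on (integrable_const _).integrableOn
            (hint' _).abs.integrableOn Metric.isOpen_ball.measurableSet fun y hy => ?_
          have h1 : dist (D (t - a - y)) (D (t - (a + s))) < ε / 2 := by
            apply hδD
            rw [Real.dist_eq]
            rw [Metric.mem_ball, Real.dist_eq, abs_sub_comm] at hy
            convert hy using 2
            ring
          rw [Real.dist_eq] at h1
          have h2 := abs_sub_le (D (t - (a + s))) (D (t - a - y)) η
          rw [abs_sub_comm (D (t - (a + s))) (D (t - a - y))] at h2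
          linarith
      _ ≤ ∫ y, |D (t - a - y) - η| ∂F :=
          setIntegral_le_integral (hint' _).abs (Eventually.of_forall fun _ => abs_nonneg _)
  exact absurd (hle.trans (le_abs_self _)) (not_le.2 ht)

/-- The increment `D` inherits the asymptotic renewal equation. If its limsup `η` were positive,
values near `η` would propagate to the translates by the monoid generated by the support, hence
nearly to all large translates. Many consecutive increments above `η / 2` would then telescope to a
difference that the bounded `Z` cannot have. -/
lemma eventually_add_sub_lt (hF : IsNonarithmetic F) (hF0 : F (Iio 0) = 0) {Z : ℝ → ℝ}
    (hZ : UniformContinuous Z) {C : ℝ} (hC : ∀ t, |Z t| ≤ C)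
    (hren : Tendsto (fun t => Z t - ∫ y, Z (t - y) ∂F) atTop (𝓝 0)) {h : ℝ} (hh : 0 < h)
    {ε : ℝ} (hε : 0 < ε) : ∀ᶠ t in atTop, Z (t + h) - Z t < ε := by
  set D : ℝ → ℝ := fun t => Z (t + h) - Z t with hDdef
  have hDu : UniformContinuous D :=
    (hZ.comp (uniformContinuous_id.add uniformContinuous_const)).sub hZ
  have hDC : ∀ t, |D t| ≤ 2 * C := fun t => by
    have := abs_sub (Z (t + h)) (Z t)
    have h1 := hC (t + h)
    have h2 := hC t
    simp only [hDdef]; linarith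
  have hint : ∀ t, Integrable (fun y => Z (t - y)) F := fun t =>
    Integrable.of_bound (hZ.continuous.comp (by fun_prop)).aestronglyMeasurable C
      (Eventually.of_forall fun y => hC _)
  have hDren : Tendsto (fun t => D t - ∫ y, D (t - y) ∂F) atTop (𝓝 0) := by
    have h1 := (hren.comp (tendsto_atTop_add_const_right _ h tendsto_id)).sub hren
    rw [sub_zero] at h1
    refine h1.congr fun t => ?_
    have : ∫ y, D (t - y) ∂F = ∫ y, Z (t + h - y) ∂F - ∫ y, Z (t - y) ∂F := by
      rw [← integral_sub (hint _) (hint _)]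
      simp only [hDdef]
      congr 1 with y
      rw [sub_add_eq_add_sub]
    rw [this]
    simp only [hDdef, Function.comp_apply, id]
    ring
  have hbdd : IsBoundedUnder (· ≤ ·) atTop D :=
    isBoundedUnder_of ⟨2 * C, fun t => (abs_le.1 (hDC t)).2⟩
  have hbdd' : IsBoundedUnder (· ≥ ·) atTop D :=
    isBoundedUnder_of ⟨-(2 * C), fun t => (abs_le.1 (hDC t)).1⟩
  set η := limsup D atTop with hηdef
  have hηup : ∀ ε > 0, ∀ᶠ t in atTop, D t < η + ε := fun ε hε =>
    eventually_lt_of_limsup_lt (by linarith) hbdd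
  suffices hη : η ≤ 0 by
    filter_upwards [hηup ε hε] with t ht
    linarith
  -- This filter plays the role of a sequence `tₙ → ∞` with `D tₙ → η`.
  set l : Filter ℝ := atTop ⊓ comap D (𝓝 η) with hldef
  have hl : l ≤ atTop := inf_le_left
  have hDl : Tendsto D l (𝓝 η) := tendsto_comap.mono_left inf_le_right
  have hne : l.NeBot := by
    rw [hldef, inf_neBot_iff_frequently_right]
    intro p hp
    obtain ⟨u, hu, hup⟩ := mem_comap.1 hp
    obtain ⟨δ, hδ, hδu⟩ := Metric.mem_nhds_iff.1 hu
    have h1 : ∃ᶠ t in atTop, η - δ < D t :=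
      frequently_lt_of_lt_limsup hbdd'.isCoboundedUnder_le (by linarith)
    refine (h1.and_eventually (hηup δ hδ)).mono fun t ht => hup (hδu ?_)
    rw [Metric.mem_ball, Real.dist_eq, abs_lt]
    constructor <;> linarith [ht.1, ht.2]
  have hmon : ∀ a ∈ AddSubmonoid.closure F.support, Tendsto (fun t => D (t - a)) l (𝓝 η) := by
    intro a ha
    induction ha using AddSubmonoid.closure_induction_right with
    | zero => simpa using hDl
    | add_right x _ y hy hx => exact tendsto_sub_of_mem_support hDu hDC hDren hηup hl hx hy
  by_contra! hηpos
  obtain ⟨δ, hδ, hδD⟩ := Metric.uniformContinuous_iff.1 hDu (η / 4) (by positivity)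
  obtain ⟨y₀, hy₀⟩ := eventually_atTop.1 (hF.eventually_exists_mem_closure_support hF0 hδ)
  have hlow : ∀ y ≥ y₀, ∀ᶠ t in l, η / 2 < D (t - y) := by
    intro y hy
    obtain ⟨a, ha, hya⟩ := hy₀ y hy
    filter_upwards [Metric.tendsto_nhds.1 (hmon a ha) (η / 4) (by positivity)] with t ht
    have h1 : dist (D (t - y)) (D (t - a)) < η / 4 := by
      apply hδD
      rw [Real.dist_eq, abs_sub_comm]
      convert hya using 2
      ring
    rw [Real.dist_eq, abs_lt] at ht h1
    linarith [ht.1, h1.1]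
  -- The bound `2 * C` dominates every difference of two values of `Z`, so `N` increments above `η /
  -- 2` are too many.
  obtain ⟨N, hN⟩ := exists_nat_gt (2 * C / (η / 2))
  rw [div_lt_iff₀ (by positivity)] at hN
  have hall : ∀ᶠ t in l, ∀ j ∈ Finset.range N, η / 2 < D (t - (y₀ + j * h)) := by
    rw [eventually_all_finset]
    exact fun j _ => hlow _ (by nlinarith [(Nat.cast_nonneg j : (0 : ℝ) ≤ j)])
  obtain ⟨t, ht⟩ := hall.exists
  have hsum : ∑ j ∈ Finset.range N, D (t - (y₀ + j * h)) =
      Z (t - y₀ + h) - Z (t - y₀ + h - N * h) := by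
    have := Finset.sum_range_sub' (fun j : ℕ => Z (t - y₀ + h - j * h)) N
    simp only [Nat.cast_zero, zero_mul, sub_zero] at this
    rw [← this]
    refine Finset.sum_congr rfl fun j _ => ?_
    simp only [hDdef]
    push_cast
    congr 2 <;> ring
  have hge : N • (η / 2) ≤ ∑ j ∈ Finset.range N, D (t - (y₀ + j * h)) := by
    have := Finset.card_nsmul_le_sum (Finset.range N) (fun j : ℕ => D (t - (y₀ + j * h))) (η / 2)
      fun j hj => (ht j hj).le
    rwa [Finset.card_range] at this
  rw [hsum, nsmul_eq_mul] at hge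
  have h1 := abs_le.1 (hC (t - y₀ + h))
  have h2 := abs_le.1 (hC (t - y₀ + h - N * h))
  linarith

/-- A bounded, uniformly continuous, asymptotic solution `Z` of `Z = F ⋆ Z` is asymptotically
invariant under translations. -/
lemma tendsto_add_sub_of_renewal (hF : IsNonarithmetic F) (hF0 : F (Iio 0) = 0) {Z : ℝ → ℝ}
    (hZ : UniformContinuous Z) {C : ℝ} (hC : ∀ t, |Z t| ≤ C)
    (hren : Tendsto (fun t => Z t - ∫ y, Z (t - y) ∂F) atTop (𝓝 0)) {h : ℝ} (hh : 0 < h) :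
    Tendsto (fun t => Z (t + h) - Z t) atTop (𝓝 0) := by
  rw [Metric.tendsto_nhds]
  intro ε hε
  have hneg : Tendsto (fun t => -Z t - ∫ y, -Z (t - y) ∂F) atTop (𝓝 0) := by
    have := hren.neg
    rw [neg_zero] at this
    refine this.congr fun t => ?_
    rw [integral_neg]; ring
  filter_upwards [eventually_add_sub_lt hF hF0 hZ hC hren hh hε,
    eventually_add_sub_lt hF hF0 (Z := fun t => -Z t) hZ.neg (by simpa using hC) hneg hh hε]
    with t h1 h2
  rw [Real.dist_eq, sub_zero, abs_lt]
  constructor <;> linarith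

end Shift

/-! ### The renewal measure and its uniform local bound. -/

/-- The `n`-fold convolution power of a measure on `ℝ`. -/
noncomputable def convPow (F : Measure ℝ) : ℕ → Measure ℝ
  | 0 => Measure.dirac 0
  | n + 1 => F ∗ convPow F n

/-- The renewal measure `∑ n, F^{*n}`. -/
noncomputable def renewalMeasure (F : Measure ℝ) : Measure ℝ := Measure.sum (convPow F)

/-- Otherwise `F` would be concentrated at 0, a point of every lattice. -/
lemma IsNonarithmetic.exists_measure_Ioi_pos {F : Measure ℝ} (hF : IsNonarithmetic F) (hF0 : F (Iio 0) = 0) :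
    ∃ δ > 0, F (Ioi δ) ≠ 0 := by
  by_contra! hcon
  refine hF 1 one_pos ?_
  have h1 : F (Ioi 0) = 0 := by
    have : Ioi (0 : ℝ) = ⋃ n : ℕ, Ioi (1 / ((n : ℝ) + 1)) := by
      ext y
      simp only [mem_Ioi, mem_iUnion]
      exact ⟨fun h => exists_nat_one_div_lt h, fun ⟨n, hn⟩ => lt_trans (by positivity) hn⟩
    rw [this, measure_iUnion_null_iff]
    exact fun n => hcon _ (by positivity)
  have h2 : ∀ᵐ y ∂F, ¬ y ∈ Ioi (0 : ℝ) := measure_eq_zero_iff_ae_notMem.1 h1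
  have h3 : ∀ᵐ y ∂F, ¬ y ∈ Iio (0 : ℝ) := measure_eq_zero_iff_ae_notMem.1 hF0
  filter_upwards [h2, h3] with y h2 h3
  simp only [mem_Ioi, mem_Iio, not_lt] at h2 h3
  exact ⟨0, by simp [le_antisymm h2 h3]⟩

section Renewal

variable {F : Measure ℝ} [IsProbabilityMeasure F]

instance isProbabilityMeasure_convPow (n : ℕ) : IsProbabilityMeasure (convPow F n) := by
  induction n with
  | zero => unfold convPow; infer_instance
  | succ n ih => unfold convPow; infer_instance

instance sFinite_renewalMeasure : SFinite (renewalMeasure F) := by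
  unfold renewalMeasure; infer_instance

lemma convPow_succ' (n : ℕ) : convPow F (n + 1) = convPow F n ∗ F :=
  Measure.conv_comm _ _

lemma lintegral_renewalMeasure {f : ℝ → ℝ≥0∞} (hf : Measurable f) :
    ∫⁻ u, f u ∂renewalMeasure F = f 0 + ∫⁻ y, ∫⁻ u, f (y + u) ∂renewalMeasure F ∂F := by
  simp only [renewalMeasure, lintegral_sum_measure]
  rw [tsum_eq_zero_add' ENNReal.summable, lintegral_tsum]
  · congr 1
    · simp [convPow, lintegral_dirac' _ hf]
    · congr 1 with n
      rw [convPow, Measure.lintegral_conv hf]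
  · intro n
    exact (Measurable.lintegral_prod_right' (f := fun p : ℝ × ℝ => f (p.1 + p.2))
      (by fun_prop)).aemeasurable

lemma convPow_Iio_zero (hF0 : F (Iio 0) = 0) (n : ℕ) : convPow F n (Iio 0) = 0 := by
  induction n with
  | zero => simp [convPow]
  | succ n ih =>
    rw [convPow, Measure.conv, Measure.map_apply (by fun_prop) measurableSet_Iio]
    refine measure_mono_null (t := (Iio 0 ×ˢ univ) ∪ (univ ×ˢ Iio 0)) ?_ ?_
    · rintro ⟨a, b⟩ h
      simp only [mem_preimage, mem_Iio, mem_union, mem_prod, mem_univ, and_true, true_and] at *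
      by_contra! hcon
      linarith
    · rw [measure_union_null_iff, Measure.prod_prod, Measure.prod_prod, hF0, ih]
      simp

lemma renewalMeasure_Iio_zero (hF0 : F (Iio 0) = 0) : renewalMeasure F (Iio 0) = 0 := by
  rw [renewalMeasure, Measure.sum_apply _ measurableSet_Iio]
  simp [convPow_Iio_zero hF0]

/-- A walk with nonnegative steps can be in `(-∞, t]` at time `n + 1` only if it was there at time
`n`. If it was in `[t - δ, t]`, a step larger than `δ` takes it out. -/
lemma convPow_succ_Iic_add_le (hF0 : F (Iio 0) = 0) (δ t : ℝ) (n : ℕ) :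
    convPow F (n + 1) (Iic t) + F (Ioi δ) * convPow F n (Icc (t - δ) t) ≤
      convPow F n (Iic t) := by
  have h1 : convPow F (n + 1) (Iic t) = ∫⁻ u, F (Iic (t - u)) ∂convPow F n := by
    rw [convPow_succ', Measure.conv, Measure.map_apply (by fun_prop) measurableSet_Iic,
      Measure.prod_apply (measurableSet_Iic.preimage (by fun_prop))]
    congr 1 with u
    congr 1 with y
    simp [le_sub_iff_add_le']
  rw [h1, ← lintegral_indicator_const measurableSet_Icc, ← lintegral_indicator_one measurableSet_Iic,
    ← lintegral_add_right _ (measurable_const.indicator measurableSet_Icc)]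
  refine lintegral_mono fun u => ?_
  simp only [indicator_apply, mem_Icc, mem_Iic, Pi.one_apply]
  split_ifs with h2 h3 h3
  · rw [← measure_union _ measurableSet_Ioi]
    · exact prob_le_one
    · rw [Set.disjoint_left]
      intro y hy hy'
      simp only [mem_Iic, mem_Ioi] at hy hy'
      linarith [h2.1]
  · exact absurd h2.2 h3
  · simpa using prob_le_one
  · rw [measure_mono_null _ hF0]
    · simp
    · intro y hy
      simp only [mem_Iic, mem_Iio, not_le] at *
      linarith

/-- The preceding inequality telescopes in `n`. In probabilistic terms, the walk leaves `(-∞, t]` at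
most once, while each visit to `[t - δ, t]` is followed by an exit with probability at least `F (Ioi
δ)`. -/
lemma mul_renewalMeasure_Icc_le_one (hF0 : F (Iio 0) = 0) (δ t : ℝ) :
    F (Ioi δ) * renewalMeasure F (Icc (t - δ) t) ≤ 1 := by
  have h : ∀ N : ℕ, convPow F N (Iic t) +
      ∑ n ∈ Finset.range N, F (Ioi δ) * convPow F n (Icc (t - δ) t) ≤ 1 := by
    intro N
    induction N with
    | zero => simpa using prob_le_one
    | succ N ih =>
      rw [Finset.sum_range_succ, add_comm (∑ _ ∈ _, _), ← add_assoc]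
      exact (add_le_add_left (convPow_succ_Iic_add_le hF0 δ t N) _).trans ih
  rw [renewalMeasure, Measure.sum_apply _ measurableSet_Icc, ← ENNReal.tsum_mul_left,
    ENNReal.tsum_eq_iSup_nat]
  exact iSup_le fun N => le_add_self.trans (h N)

/-- The renewal measure of intervals of a given length is bounded. -/
lemma exists_renewalMeasure_Icc_le (hF : IsNonarithmetic F) (hF0 : F (Iio 0) = 0) (a : ℝ) :
    ∃ C : ℝ≥0, ∀ t, renewalMeasure F (Icc t (t + a)) ≤ C := by
  obtain ⟨δ, hδ, hp⟩ := hF.exists_measure_Ioi_pos hF0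
  have hbase : ∀ t, renewalMeasure F (Icc t (t + δ)) ≤ (F (Ioi δ))⁻¹ := fun t => by
    have := mul_renewalMeasure_Icc_le_one hF0 δ (t + δ)
    rw [add_sub_cancel_right, mul_comm] at this
    rw [← one_div]
    exact (ENNReal.le_div_iff_mul_le (Or.inl hp) (Or.inl (measure_ne_top _ _))).2 this
  have hstep : ∀ n : ℕ, ∀ t, renewalMeasure F (Icc t (t + (n + 1) * δ)) ≤
      (n + 1) * (F (Ioi δ))⁻¹ := by
    intro n
    induction n with
    | zero => simpa using hbase
    | succ n ih =>
      intro t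
      have hsub : Icc t (t + ((n + 1 : ℕ) + 1) * δ) ⊆
          Icc t (t + δ) ∪ Icc (t + δ) (t + δ + (n + 1) * δ) := by
        intro y hy
        push_cast at hy
        rcases le_total y (t + δ) with h | h
        · exact Or.inl ⟨hy.1, h⟩
        · exact Or.inr ⟨h, by linarith [hy.2]⟩
      refine (measure_mono hsub).trans ((measure_union_le _ _).trans
        ((add_le_add (hbase t) (ih (t + δ))).trans (le_of_eq ?_)))
      push_cast
      ring
  obtain ⟨n, hn⟩ := exists_nat_gt (a / δ)
  rw [div_lt_iff₀ hδ] at hn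
  have hfin : (n + 1) * (F (Ioi δ))⁻¹ ≠ ∞ :=
    ENNReal.mul_ne_top (by simp) (ENNReal.inv_ne_top.2 hp)
  refine ⟨((n + 1) * (F (Ioi δ))⁻¹).toNNReal, fun t => ?_⟩
  rw [ENNReal.coe_toNNReal hfin]
  refine (measure_mono (Icc_subset_Icc_right ?_)).trans (hstep n t)
  linarith

/-! ### Smoothed renewal functions `t ↦ ∫ g (t - u) U(du)`. -/

section Kernel

variable {g : ℝ → ℝ}

lemma HasCompactSupport.exists_abs_le (hgc : HasCompactSupport g) :
    ∃ a > 0, ∀ u, g u ≠ 0 → |u| ≤ a := by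
  obtain ⟨a, ha, h⟩ := hgc.isCompact.isBounded.exists_pos_norm_le
  exact ⟨a, ha, fun u hu => h u (subset_tsupport _ hu)⟩

lemma integrable_renewalMeasure (hF : IsNonarithmetic F) (hF0 : F (Iio 0) = 0)
    (hg : Continuous g) (hgc : HasCompactSupport g) (t : ℝ) :
    Integrable (fun u => g (t - u)) (renewalMeasure F) := by
  obtain ⟨a, ha, hga⟩ := hgc.exists_abs_le
  obtain ⟨C, hC⟩ := exists_renewalMeasure_Icc_le hF hF0 (2 * a)
  obtain ⟨M, hM⟩ := hgc.exists_bound_of_continuous hg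
  rw [← integrableOn_iff_integrable_of_support_subset (s := Icc (t - a) (t - a + 2 * a))]
  · exact Measure.integrableOn_of_bounded (M := M) ((hC _).trans_lt ENNReal.coe_lt_top).ne
      (hg.comp (by fun_prop)).aestronglyMeasurable (Eventually.of_forall fun u => hM _)
  · intro u hu
    have := abs_le.1 (hga _ hu)
    constructor <;> linarith

/-- Both translates of `g` vanish outside one window of radius `a + 1` around `t`, whose renewal
mass is bounded independently of `t`. This turns uniform continuity of `g` into that of its
convolution with `U`. -/
lemma exists_integral_renewalMeasure_bound (hF : IsNonarithmetic F) (hF0 : F (Iio 0) = 0)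
    (hgc : HasCompactSupport g) : ∃ K > 0, ∀ M t t', |t - t'| ≤ 1 → 0 ≤ M →
      (∀ u, |g (t - u) - g (t' - u)| ≤ M) →
      |∫ u, (g (t - u) - g (t' - u)) ∂renewalMeasure F| ≤ K * M := by
  obtain ⟨a, ha, hga⟩ := hgc.exists_abs_le
  obtain ⟨C, hC⟩ := exists_renewalMeasure_Icc_le hF hF0 (2 * (a + 1))
  refine ⟨C + 1, by positivity, fun M t t' htt hM hgM => ?_⟩
  rw [abs_le] at htt
  have hsupp : ∀ u, u ∉ Icc (t - (a + 1)) (t - (a + 1) + 2 * (a + 1)) →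
      g (t - u) - g (t' - u) = 0 := by
    intro u hu
    by_contra hne
    refine hu ?_
    by_cases h : g (t - u) = 0
    · have h' : g (t' - u) ≠ 0 := fun h' => hne (by rw [h, h', sub_zero])
      have := abs_le.1 (hga _ h')
      constructor <;> linarith
    · have := abs_le.1 (hga _ h)
      constructor <;> linarith
  rw [← setIntegral_eq_integral_of_forall_compl_eq_zero hsupp]
  have h1 := norm_setIntegral_le_of_norm_le_const (μ := renewalMeasure F) (C := M)
    (f := fun u => g (t - u) - g (t' - u)) ((hC (t - (a + 1))).trans_lt ENNReal.coe_lt_top)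
    (fun u _ => hgM u)
  have h2 : (renewalMeasure F).real (Icc (t - (a + 1)) (t - (a + 1) + 2 * (a + 1))) ≤ C :=
    ENNReal.toReal_le_coe_of_le_coe (hC _)
  rw [Real.norm_eq_abs] at h1
  nlinarith

lemma uniformContinuous_integral_renewalMeasure (hF : IsNonarithmetic F) (hF0 : F (Iio 0) = 0)
    (hg : Continuous g) (hgc : HasCompactSupport g) :
    UniformContinuous fun t => ∫ u, g (t - u) ∂renewalMeasure F := by
  obtain ⟨K, hK, hbound⟩ := exists_integral_renewalMeasure_bound hF hF0 hgc
  have hgu := hgc.uniformContinuous_of_continuous hg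
  rw [Metric.uniformContinuous_iff] at hgu ⊢
  intro ε hε
  obtain ⟨δ, hδ, hδg⟩ := hgu (ε / (2 * K)) (by positivity)
  refine ⟨min δ 1, by positivity, fun t t' htt => ?_⟩
  have h1 := hbound (ε / (2 * K)) t t' (by
    rw [← Real.dist_eq]; exact (htt.trans_le (min_le_right _ _)).le) (by positivity) (fun u => by
    rw [← Real.dist_eq]
    refine (hδg ?_).le
    rw [dist_sub_right]
    exact htt.trans_le (min_le_left _ _))
  rw [Real.dist_eq, ← integral_sub (integrable_renewalMeasure hF hF0 hg hgc _)
    (integrable_renewalMeasure hF hF0 hg hgc _)]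
  have : K * (ε / (2 * K)) = ε / 2 := by field_simp
  linarith

lemma exists_abs_integral_renewalMeasure_le (hF : IsNonarithmetic F) (hF0 : F (Iio 0) = 0)
    (hg : Continuous g) (hgc : HasCompactSupport g) :
    ∃ C, ∀ t, |∫ u, g (t - u) ∂renewalMeasure F| ≤ C := by
  obtain ⟨a, ha, hga⟩ := hgc.exists_abs_le
  obtain ⟨C, hC⟩ := exists_renewalMeasure_Icc_le hF hF0 (2 * a)
  obtain ⟨M, hM⟩ := hgc.exists_bound_of_continuous hg
  refine ⟨M * C, fun t => ?_⟩
  rw [← setIntegral_eq_integral_of_forall_compl_eq_zero (s := Icc (t - a) (t - a + 2 * a))]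
  · refine (norm_setIntegral_le_of_norm_le_const ((hC (t - a)).trans_lt ENNReal.coe_lt_top)
      (fun u _ => hM _)).trans ?_
    exact mul_le_mul_of_nonneg_left (ENNReal.toReal_le_coe_of_le_coe (hC _))
      ((norm_nonneg _).trans (hM 0))
  · intro u hu
    by_contra hne
    have := abs_le.1 (hga _ hne)
    exact hu (by constructor <;> linarith)

lemma ofReal_integral_renewalMeasure (hF : IsNonarithmetic F) (hF0 : F (Iio 0) = 0)
    (hg : Continuous g) (hgc : HasCompactSupport g) (hg0 : ∀ u, 0 ≤ g u) (t : ℝ) :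
    ENNReal.ofReal (∫ u, g (t - u) ∂renewalMeasure F) =
      ∫⁻ u, ENNReal.ofReal (g (t - u)) ∂renewalMeasure F :=
  ofReal_integral_eq_lintegral_ofReal (integrable_renewalMeasure hF hF0 hg hgc t)
    (Eventually.of_forall fun _ => hg0 _)

/-- The renewal equation for `t ↦ ∫ g (t - u) U(du)`. -/
lemma integral_renewalMeasure_eq (hF : IsNonarithmetic F) (hF0 : F (Iio 0) = 0)
    (hg : Continuous g) (hgc : HasCompactSupport g) (hg0 : ∀ u, 0 ≤ g u) (t : ℝ) :
    ∫ u, g (t - u) ∂renewalMeasure F =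
      g t + ∫ y, ∫ u, g (t - y - u) ∂renewalMeasure F ∂F := by
  have hnn : ∀ t, 0 ≤ ∫ u, g (t - u) ∂renewalMeasure F := fun t =>
    integral_nonneg fun _ => hg0 _
  obtain ⟨C, hC⟩ := exists_abs_integral_renewalMeasure_le hF hF0 hg hgc
  have hu := (uniformContinuous_integral_renewalMeasure hF hF0 hg hgc).continuous
  have hint : Integrable (fun y => ∫ u, g (t - y - u) ∂renewalMeasure F) F :=
    Integrable.of_bound (hu.comp (g := fun t => ∫ u, g (t - u) ∂renewalMeasure F)
      (f := fun y => t - y) (by fun_prop)).aestronglyMeasurable C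
      (Eventually.of_forall fun y => hC _)
  have hin : 0 ≤ ∫ y, ∫ u, g (t - y - u) ∂renewalMeasure F ∂F := integral_nonneg fun _ => hnn _
  rw [← ENNReal.ofReal_eq_ofReal_iff (hnn t) (add_nonneg (hg0 t) hin),
    ENNReal.ofReal_add (hg0 t) hin, ofReal_integral_renewalMeasure hF hF0 hg hgc hg0,
    lintegral_renewalMeasure (by fun_prop),
    ofReal_integral_eq_lintegral_ofReal hint (Eventually.of_forall fun _ => hnn _)]
  simp only [sub_zero, ofReal_integral_renewalMeasure hF hF0 hg hgc hg0]
  simp only [sub_sub]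

/-- Beyond the support of `g` the inhomogeneous term of the renewal equation is exactly 0, so the
invariance result for asymptotic solutions applies. -/
lemma tendsto_integral_renewalMeasure_sub (hF : IsNonarithmetic F) (hF0 : F (Iio 0) = 0)
    (hg : Continuous g) (hgc : HasCompactSupport g) (hg0 : ∀ u, 0 ≤ g u) {s : ℝ} (hs : 0 < s) :
    Tendsto (fun t => (∫ u, g (t - s - u) ∂renewalMeasure F) - ∫ u, g (t - u) ∂renewalMeasure F)
      atTop (𝓝 0) := by
  obtain ⟨C, hC⟩ := exists_abs_integral_renewalMeasure_le hF hF0 hg hgc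
  have h := tendsto_add_sub_of_renewal hF hF0
    (uniformContinuous_integral_renewalMeasure hF hF0 hg hgc) hC ?_ hs
  · have := (h.comp (tendsto_atTop_add_const_right _ (-s) tendsto_id)).neg
    rw [neg_zero] at this
    refine this.congr fun t => ?_
    simp [← sub_eq_add_neg]
  · obtain ⟨a, ha, hga⟩ := hgc.exists_abs_le
    refine tendsto_const_nhds.congr' ?_
    filter_upwards [eventually_gt_atTop a] with t ht
    rw [integral_renewalMeasure_eq hF hF0 hg hgc hg0 t, add_sub_cancel_right]
    by_contra hne
    exact absurd (hga t (Ne.symm hne)) (not_le.2 (ht.trans_le (le_abs_self t)))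

end Kernel

end Renewal

/-! ### The integrated tail of the step law. -/

/-- The measure `P(X > s) ds` on `(0, ∞)` for `X` of law `F`, i.e. the integrated tail of `F`. -/
noncomputable def integratedTail (F : Measure ℝ) : Measure ℝ :=
  ((F.prod volume).restrict {p | 0 < p.2 ∧ p.2 ≤ p.1}).map Prod.snd

lemma exists_continuous_between_indicator {K U : Set ℝ} (hK : IsCompact K) (hU : IsOpen U)
    (hKU : K ⊆ U) : ∃ g : ℝ → ℝ, Continuous g ∧ HasCompactSupport g ∧ (∀ u, 0 ≤ g u) ∧
      (∀ u, K.indicator 1 u ≤ g u) ∧ ∀ u, g u ≤ U.indicator 1 u := by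
  obtain ⟨g, h1, h0, hc, h01⟩ := exists_continuous_one_zero_of_isCompact hK hU.isClosed_compl
    (disjoint_compl_right_iff_subset.2 hKU)
  refine ⟨g, g.continuous, hc, fun u => (h01 u).1, fun u => ?_, fun u => ?_⟩
  · by_cases h : u ∈ K
    · simp [h, h1 h]
    · simpa [h] using (h01 u).1
  · by_cases h : u ∈ U
    · simpa [h] using (h01 u).2
    · simp [h, h0 (show u ∈ Uᶜ from h)]

section IntegratedTail

variable {F : Measure ℝ}

lemma lintegral_integratedTail {h : ℝ → ℝ≥0∞} (hh : Measurable h) :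
    ∫⁻ s, h s ∂integratedTail F = ∫⁻ y, (∫⁻ s in Ioc 0 y, h s) ∂F := by
  have hms : MeasurableSet {p : ℝ × ℝ | 0 < p.2 ∧ p.2 ≤ p.1} :=
    (measurableSet_lt measurable_const measurable_snd).inter
      (measurableSet_le measurable_snd measurable_fst)
  rw [integratedTail, lintegral_map hh measurable_snd, ← lintegral_indicator hms,
    lintegral_prod (fun p : ℝ × ℝ => {p : ℝ × ℝ | 0 < p.2 ∧ p.2 ≤ p.1}.indicator (fun p => h p.2) p)
      ((hh.comp measurable_snd).indicator hms).aemeasurable]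
  refine lintegral_congr fun y => ?_
  rw [← lintegral_indicator measurableSet_Ioc]
  rfl

lemma integratedTail_univ : integratedTail F univ = ∫⁻ y, ENNReal.ofReal y ∂F := by
  rw [← lintegral_one, lintegral_integratedTail measurable_const]
  simp only [setLIntegral_one, Real.volume_Ioc, sub_zero]

lemma ae_integratedTail_pos : ∀ᵐ s ∂integratedTail F, 0 < s := by
  have hm : MeasurableSet {s : ℝ | ¬ 0 < s} := (measurableSet_lt measurable_const measurable_id).compl
  rw [ae_iff, ← lintegral_indicator_one hm,
    lintegral_integratedTail (measurable_one.indicator hm), ← nonpos_iff_eq_zero]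
  refine (lintegral_mono (g := fun _ => 0) fun y => ?_).trans (lintegral_zero (μ := F)).le
  rw [nonpos_iff_eq_zero, setLIntegral_eq_zero_iff measurableSet_Ioc
    (measurable_one.indicator hm)]
  refine Eventually.of_forall fun s hs => ?_
  simp [hs.1]

end IntegratedTail

/-! ### The key renewal theorem and Blackwell's theorem. -/

section Blackwell

variable {F : Measure ℝ} [IsProbabilityMeasure F] {g : ℝ → ℝ}

/-- The convolution of the renewal measure with the integrated tail is Lebesgue measure on
`[0, ∞)`. -/
lemma lintegral_lintegral_renewalMeasure_integratedTail (hF : IsNonarithmetic F)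
    (hF0 : F (Iio 0) = 0) (hg : Continuous g) (hgc : HasCompactSupport g) (t : ℝ) :
    ∫⁻ s, ∫⁻ u, ENNReal.ofReal (g (t - s - u)) ∂renewalMeasure F ∂integratedTail F =
      ∫⁻ s in Ioi 0, ENNReal.ofReal (g (t - s)) := by
  obtain ⟨a, ha, hga⟩ := hgc.exists_abs_le
  set G : ℝ → ℝ≥0∞ := fun u => ENNReal.ofReal (g u) with hG
  have hGm : Measurable G := by fun_prop
  -- With `ψ = G ∗ 1_{(0,∞)}` and `V = ψ ∗ U`, the renewal equation gives `V = ψ + F ∗ V`. On the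
  -- other hand `V t - V (t - y)` is the integral of `G ∗ U` over a window of length `y`, and
  -- averaging over `y` of law `F` gives `V = F ∗ V + (G ∗ U) ∗ integratedTail F`. Cancelling `F ∗
  -- V` leaves the claim.
  set ψ : ℝ → ℝ≥0∞ := fun t => ∫⁻ s in Ioi 0, G (t - s) with hψ
  have hψm : Measurable ψ :=
    Measurable.lintegral_prod_right' (f := fun p : ℝ × ℝ => G (p.1 - p.2)) (by fun_prop)
  set V : ℝ → ℝ≥0∞ := fun t => ∫⁻ u, ψ (t - u) ∂renewalMeasure F with hV
  have hVm : Measurable V :=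
    Measurable.lintegral_prod_right' (f := fun p : ℝ × ℝ => ψ (p.1 - p.2)) (by fun_prop)
  have hψstep : ∀ y ≥ 0, ∀ t, ψ t = ψ (t - y) + ∫⁻ s in Ioc 0 y, G (t - s) := by
    intro y hy t
    have h1 : ψ (t - y) = ∫⁻ s in Ioi y, G (t - s) := by
      have := (measurePreserving_add_left volume y).setLIntegral_comp_preimage
        (measurableSet_Ioi (a := y)) (f := fun s => G (t - s)) (by fun_prop)
      simpa [← sub_sub] using this
    rw [h1, add_comm, ← lintegral_union measurableSet_Ioi
      (by rw [Set.disjoint_left]; intro z hz hz'; exact absurd hz.2 (not_le.2 hz')),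
      Ioc_union_Ioi_eq_Ioi hy]
  have hVstep : ∀ y ≥ 0, V t = V (t - y) +
      ∫⁻ s in Ioc 0 y, ∫⁻ u, G (t - s - u) ∂renewalMeasure F := by
    intro y hy
    simp only [hV]
    have hm : Measurable fun u => ψ (t - y - u) := by fun_prop
    rw [lintegral_lintegral_swap (μ := volume.restrict (Ioc 0 y)) (ν := renewalMeasure F)
      (f := fun s u => G (t - s - u)) (by fun_prop), ← lintegral_add_left hm]
    refine lintegral_congr fun u => ?_
    rw [hψstep y hy (t - u)]
    simp only [sub_sub, add_comm]
  have hI : ∫⁻ s, G s ≠ ∞ := by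
    have := (hg.integrable_of_hasCompactSupport hgc (μ := volume)).lintegral_lt_top
    exact this.ne
  have hψle : ∀ t, ψ t ≤ ∫⁻ s, G s := fun t =>
    (setLIntegral_le_lintegral _ _).trans (lintegral_sub_left_eq_self (μ := volume) G t).le
  have hψ0 : ∀ t < -a, ψ t = 0 := by
    intro t ht
    simp only [hψ]
    rw [setLIntegral_eq_zero_iff measurableSet_Ioi (by fun_prop)]
    refine Eventually.of_forall fun s hs => ?_
    simp only [mem_Ioi] at hs
    by_contra hne
    have : g (t - s) ≠ 0 := fun h => hne (by simp [hG, h])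
    have := abs_le.1 (hga _ this)
    linarith [this.1]
  -- Finiteness is what permits the cancellation in `ℝ≥0∞`. It holds because only `u` in `[0, t +
  -- a]` contribute to `V t`.
  have hVfin : V t ≠ ∞ := by
    obtain ⟨C, hC⟩ := exists_renewalMeasure_Icc_le hF hF0 (t + a)
    have hle : V t ≤ ∫⁻ u in Icc 0 (0 + (t + a)), (∫⁻ s, G s) ∂renewalMeasure F := by
      rw [← lintegral_indicator measurableSet_Icc]
      refine lintegral_mono_ae ?_
      filter_upwards [measure_eq_zero_iff_ae_notMem.1 (renewalMeasure_Iio_zero hF0)] with u hu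
      rw [mem_Iio, not_lt] at hu
      by_cases h : u ≤ 0 + (t + a)
      · rw [indicator_of_mem (show u ∈ Icc 0 (0 + (t + a)) from ⟨hu, h⟩)]
        exact hψle _
      · rw [hψ0 _ (by linarith)]
        exact zero_le
    refine (hle.trans_lt ?_).ne
    rw [setLIntegral_const]
    exact ENNReal.mul_lt_top hI.lt_top ((hC 0).trans_lt ENNReal.coe_lt_top)
  have hren : V t = ψ t + ∫⁻ y, V (t - y) ∂F := by
    simp only [hV]
    rw [lintegral_renewalMeasure (by fun_prop)]
    simp only [sub_zero, sub_sub]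
  have hsplit : V t = ∫⁻ y, V (t - y) ∂F +
      ∫⁻ s, ∫⁻ u, G (t - s - u) ∂renewalMeasure F ∂integratedTail F := by
    have hm : Measurable fun s => ∫⁻ u, G (t - s - u) ∂renewalMeasure F :=
      Measurable.lintegral_prod_right' (f := fun p : ℝ × ℝ => G (t - p.1 - p.2)) (by fun_prop)
    have hm' : Measurable fun y => V (t - y) := by fun_prop
    rw [lintegral_integratedTail hm, ← lintegral_add_left hm']
    have : V t = ∫⁻ _, V t ∂F := by simp
    rw [this]
    refine lintegral_congr_ae ?_
    filter_upwards [measure_eq_zero_iff_ae_notMem.1 hF0] with y hy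
    exact hVstep y (not_lt.1 hy)
  have hfin' : ∫⁻ y, V (t - y) ∂F ≠ ∞ := ne_top_of_le_ne_top hVfin (by rw [hren]; exact le_add_self)
  have := hsplit.symm.trans hren
  rw [add_comm (ψ t)] at this
  exact (ENNReal.add_right_inj hfin').1 this

/-- **Key renewal theorem** for continuous, compactly supported functions. -/
lemma tendsto_integral_renewalMeasure (hF : IsNonarithmetic F) (hF0 : F (Iio 0) = 0)
    (hpos : ∫⁻ y, ENNReal.ofReal y ∂F ≠ 0) (hfin : ∫⁻ y, ENNReal.ofReal y ∂F ≠ ∞)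
    (hg : Continuous g) (hgc : HasCompactSupport g) (hg0 : ∀ u, 0 ≤ g u) :
    Tendsto (fun t => ∫ u, g (t - u) ∂renewalMeasure F) atTop
      (𝓝 ((∫ u, g u) / (∫⁻ y, ENNReal.ofReal y ∂F).toReal)) := by
  obtain ⟨a, ha, hga⟩ := hgc.exists_abs_le
  obtain ⟨C, hC⟩ := exists_abs_integral_renewalMeasure_le hF hF0 hg hgc
  set m := (∫⁻ y, ENNReal.ofReal y ∂F).toReal with hm
  have hm0 : 0 < m := ENNReal.toReal_pos hpos hfin
  have : IsFiniteMeasure (integratedTail F) :=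
    ⟨by rw [integratedTail_univ]; exact hfin.lt_top⟩
  set Z : ℝ → ℝ := fun t => ∫ u, g (t - u) ∂renewalMeasure F with hZ
  have hZ0 : ∀ t, 0 ≤ Z t := fun t => integral_nonneg fun _ => hg0 _
  have hZc : Continuous Z := (uniformContinuous_integral_renewalMeasure hF hF0 hg hgc).continuous
  have hint : ∀ t, Integrable (fun s => Z (t - s)) (integratedTail F) := fun t =>
    Integrable.of_bound (hZc.comp (by fun_prop)).aestronglyMeasurable C
      (Eventually.of_forall fun _ => hC _)
  -- For `t > a`, `g (t - s) ≠ 0` forces `s > 0`, so Lebesgue measure on the half-line already sees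
  -- all of `g`.
  have hid : ∀ᶠ t in atTop, ∫ s, Z (t - s) ∂integratedTail F = ∫ u, g u := by
    filter_upwards [eventually_gt_atTop a] with t ht
    rw [← ENNReal.ofReal_eq_ofReal_iff (integral_nonneg fun _ => hZ0 _)
      (integral_nonneg hg0), ofReal_integral_eq_lintegral_ofReal (hint t)
      (Eventually.of_forall fun _ => hZ0 _), ofReal_integral_eq_lintegral_ofReal
      (hg.integrable_of_hasCompactSupport hgc) (Eventually.of_forall hg0)]
    simp only [hZ, ofReal_integral_renewalMeasure hF hF0 hg hgc hg0]
    rw [lintegral_lintegral_renewalMeasure_integratedTail hF hF0 hg hgc,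
      ← lintegral_sub_left_eq_self (μ := volume) _ t, ← lintegral_indicator measurableSet_Ioi]
    refine lintegral_congr fun s => ?_
    rw [indicator_apply]
    split_ifs with hs
    · rfl
    · rw [mem_Ioi, not_lt] at hs
      have : g (t - s) = 0 := by
        by_contra hne
        have := abs_le.1 (hga _ hne)
        linarith [this.2]
      simp [this]
  -- Translation invariance holds for each fixed `s > 0`; the bound `2 * C` is integrable because
  -- the integrated tail is a finite measure.
  have hdiff : Tendsto (fun t => ∫ s, (Z (t - s) - Z t) ∂integratedTail F) atTop (𝓝 0) := by
    have := tendsto_integral_filter_of_dominated_convergence (l := atTop) (μ := integratedTail F)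
      (F := fun t s => Z (t - s) - Z t) (f := fun _ => 0) (fun _ => 2 * C)
      (Eventually.of_forall fun t => Continuous.aestronglyMeasurable (by fun_prop))
      (Eventually.of_forall fun t => Eventually.of_forall fun s => by
        have h1 := abs_sub (Z (t - s)) (Z t)
        have h2 := hC (t - s)
        have h3 := hC t
        rw [Real.norm_eq_abs]
        linarith)
      (integrable_const _)
      (by
        filter_upwards [ae_integratedTail_pos] with s hs
        exact tendsto_integral_renewalMeasure_sub hF hF0 hg hgc hg0 hs)
    simpa using this
  have hmul : Tendsto (fun t => (∫ u, g u) - m * Z t) atTop (𝓝 0) := by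
    refine hdiff.congr' ?_
    filter_upwards [hid] with t ht
    rw [integral_sub (hint t) (integrable_const _), ht, integral_const, smul_eq_mul]
    simp [Measure.real, integratedTail_univ, hm]
  have := (tendsto_const_nhds (x := ∫ u, g u)).sub hmul
  rw [sub_zero] at this
  have := this.div_const m
  refine this.congr fun t => ?_
  field_simp
  ring

/-- **Blackwell's renewal theorem.** -/
theorem tendsto_renewalMeasure_Ioc (hF : IsNonarithmetic F) (hF0 : F (Iio 0) = 0)
    (hpos : ∫⁻ y, ENNReal.ofReal y ∂F ≠ 0) (hfin : ∫⁻ y, ENNReal.ofReal y ∂F ≠ ∞)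
    {x : ℝ} (hx : 0 < x) :
    Tendsto (fun t => (renewalMeasure F).real (Ioc t (t + x))) atTop
      (𝓝 (x / (∫⁻ y, ENNReal.ofReal y ∂F).toReal)) := by
  set m := (∫⁻ y, ENNReal.ofReal y ∂F).toReal with hm
  have hm0 : 0 < m := ENNReal.toReal_pos hpos hfin
  obtain ⟨C, hC⟩ := exists_renewalMeasure_Icc_le hF hF0 x
  have hfinI : ∀ t, renewalMeasure F (Ioc t (t + x)) ≠ ∞ := fun t =>
    (((measure_mono Ioc_subset_Icc_self).trans (hC t)).trans_lt ENNReal.coe_lt_top).ne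
  have hI : ∀ t, Integrable ((Ioc t (t + x)).indicator (1 : ℝ → ℝ)) (renewalMeasure F) := fun t =>
    (integrable_indicator_iff measurableSet_Ioc).2 (integrableOn_const (hfinI t))
  have hIeq : ∀ t, (renewalMeasure F).real (Ioc t (t + x)) =
      ∫ u, (Ioc t (t + x)).indicator 1 u ∂renewalMeasure F := fun t =>
    (integral_indicator_one measurableSet_Ioc).symm
  rw [tendsto_order]
  constructor
  · intro c hc
    rw [lt_div_iff₀ hm0] at hc
    -- In the variable `t - u` the window `(t, t + x]` becomes `[-x, 0)`, which is approximated from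
    -- inside. The compact interval may be empty when `c` is very negative; the lower bound `x - 2 *
    -- ε` is then negative and remains valid.
    obtain ⟨ε, hε, hεc⟩ : ∃ ε > 0, 2 * ε < x - c * m := ⟨(x - c * m) / 4, by linarith, by linarith⟩
    obtain ⟨g, hg, hgc, hg0, hgK, hgU⟩ := exists_continuous_between_indicator
      (isCompact_Icc (a := -x + ε) (b := -ε)) (isOpen_Ioo (a := -x) (b := 0))
      (Icc_subset_Ioo (by linarith) (by linarith))
    have hgint : x - 2 * ε ≤ ∫ u, g u := by
      calc x - 2 * ε ≤ volume.real (Icc (-x + ε) (-ε)) := by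
            rw [Real.volume_real_Icc]
            exact le_max_of_le_left (by linarith)
        _ = ∫ u, (Icc (-x + ε) (-ε)).indicator 1 u := (integral_indicator_one measurableSet_Icc).symm
        _ ≤ ∫ u, g u := integral_mono ((integrable_indicator_iff measurableSet_Icc).2
            (integrableOn_const (by simp))) (hg.integrable_of_hasCompactSupport hgc) hgK
    have hlim := tendsto_integral_renewalMeasure hF hF0 hpos hfin hg hgc hg0
    filter_upwards [hlim.eventually_const_lt (u := c) (by rw [lt_div_iff₀ hm0]; linarith)] with t ht
    refine ht.trans_le ?_
    rw [hIeq]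
    refine integral_mono (integrable_renewalMeasure hF hF0 hg hgc t) (hI t) fun u => ?_
    refine (hgU _).trans ?_
    by_cases h : t - u ∈ Ioo (-x) 0
    · have h' : u ∈ Ioc t (t + x) := ⟨by linarith [h.2], by linarith [h.1]⟩
      simp [h, h']
    · rw [indicator_of_notMem h]
      exact indicator_nonneg (fun _ _ => zero_le_one) _
  · intro c hc
    rw [gt_iff_lt, div_lt_iff₀ hm0] at hc
    obtain ⟨ε, hε, hεc⟩ : ∃ ε > 0, 2 * ε < c * m - x := ⟨(c * m - x) / 4, by linarith, by linarith⟩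
    obtain ⟨g, hg, hgc, hg0, hgK, hgU⟩ := exists_continuous_between_indicator
      (isCompact_Icc (a := -x) (b := 0)) (isOpen_Ioo (a := -x - ε) (b := ε))
      (Icc_subset_Ioo (by linarith) (by linarith))
    have hgint : ∫ u, g u ≤ x + 2 * ε := by
      calc ∫ u, g u ≤ ∫ u, (Ioo (-x - ε) ε).indicator 1 u :=
            integral_mono (hg.integrable_of_hasCompactSupport hgc)
              ((integrable_indicator_iff measurableSet_Ioo).2 (integrableOn_const (by simp))) hgU
        _ = volume.real (Ioo (-x - ε) ε) := integral_indicator_one measurableSet_Ioo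
        _ = x + 2 * ε := by
            rw [Real.volume_real_Ioo_of_le (by linarith)]; ring
    have hlim := tendsto_integral_renewalMeasure hF hF0 hpos hfin hg hgc hg0
    filter_upwards [hlim.eventually_lt_const (u := c) (by rw [div_lt_iff₀ hm0]; linarith)] with t ht
    refine lt_of_le_of_lt ?_ ht
    rw [hIeq]
    refine integral_mono (hI t) (integrable_renewalMeasure hF hF0 hg hgc t) fun u => ?_
    refine le_trans ?_ (hgK _)
    by_cases h : u ∈ Ioc t (t + x)
    · have h' : t - u ∈ Icc (-x) 0 := ⟨by linarith [h.2], by linarith [h.1]⟩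
      rw [indicator_of_mem h, indicator_of_mem h']
      rfl
    · rw [indicator_of_notMem h]
      exact indicator_nonneg (fun _ _ => zero_le_one) _

end Blackwell

/-! ### Intensity measures of single clusters. -/

/-- Cut the parameter space according to the integer part of the total mass; on each piece the
kernel is bounded. Applied to `finiteCluster`, this makes composition products and Fubini available
for random clusters. -/
lemma ProbabilityTheory.Kernel.isSFiniteKernel_of_lt_top {α β : Type*} [MeasurableSpace α]
    [MeasurableSpace β] (κ : Kernel α β) (h : ∀ a, κ a univ < ∞) : IsSFiniteKernel κ := by
  classical
  have hs : ∀ n : ℕ, MeasurableSet {a | ⌊(κ a univ).toReal⌋₊ = n} := fun n =>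
    measurableSet_eq_fun (Nat.measurable_floor.comp (κ.measurable_coe .univ).ennreal_toReal)
      measurable_const
  refine ⟨fun n => Kernel.piecewise (hs n) κ 0, fun n => ⟨⟨n + 1, by simp, fun a => ?_⟩⟩, ?_⟩
  · rw [Kernel.piecewise_apply]
    split_ifs with ha
    · have h1 := (Nat.lt_floor_add_one (κ a univ).toReal).le
      rw [mem_ofPred_eq] at ha
      rw [ha] at h1
      rw [← ENNReal.ofReal_toReal (h a).ne]
      refine (ENNReal.ofReal_le_ofReal h1).trans_eq ?_
      rw [ENNReal.ofReal_add (by positivity) zero_le_one]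
      simp
    · simp
  · ext a s hms
    rw [Kernel.sum_apply' _ _ hms, tsum_eq_single ⌊(κ a univ).toReal⌋₊]
    · simp [Kernel.piecewise_apply]
    · intro n hn
      have : ¬ ⌊(κ a univ).toReal⌋₊ = n := fun h => hn h.symm
      simp [Kernel.piecewise_apply, this]

lemma measurable_clusterSize : Measurable clusterSize :=
  (Measure.measurable_coe MeasurableSet.univ).comp measurable_subtype_coe

open Classical in
/-- The kernel sending a finite point measure to itself, and all others to `0`. -/
noncomputable def finiteCluster : Kernel PointMeasure ℝ :=
  Kernel.piecewise (measurableSet_lt measurable_clusterSize measurable_const :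
    MeasurableSet {m : PointMeasure | clusterSize m < ∞}) ⟨Subtype.val, measurable_subtype_coe⟩ 0

lemma finiteCluster_apply {m : PointMeasure} (hm : clusterSize m < ∞) :
    finiteCluster m = m := by
  rw [finiteCluster, Kernel.piecewise_apply, if_pos (show m ∈ {m | clusterSize m < ∞} from hm)]
  rfl

instance isSFiniteKernel_finiteCluster : IsSFiniteKernel finiteCluster := by
  refine finiteCluster.isSFiniteKernel_of_lt_top fun m => ?_
  rw [finiteCluster, Kernel.piecewise_apply]
  split_ifs with h
  · exact h
  · simp

/-- The intensity measure of the cluster `ξ` translated by `X`, for `(ξ, X)` of law `Q`. -/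
noncomputable def clusterIntensity (Q : Measure (PointMeasure × ℝ≥0)) : Measure ℝ :=
  (Q ⊗ₘ finiteCluster.comap Prod.fst measurable_fst).map fun p => (p.1.2 : ℝ) + p.2

lemma clusterIntensity_apply (Q : Measure (PointMeasure × ℝ≥0)) [SFinite Q] {B : Set ℝ}
    (hB : MeasurableSet B) :
    clusterIntensity Q B = ∫⁻ w, finiteCluster w.1 {y | (w.2 : ℝ) + y ∈ B} ∂Q := by
  have hm : Measurable fun p : (PointMeasure × ℝ≥0) × ℝ => (p.1.2 : ℝ) + p.2 := by fun_prop
  rw [clusterIntensity, Measure.map_apply hm hB, Measure.compProd_apply (hm hB)]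
  rfl

lemma measurable_finiteCluster_translate {B : Set ℝ} (hB : MeasurableSet B) :
    Measurable fun p : (PointMeasure × ℝ≥0) × ℝ =>
      finiteCluster p.1.1 {y | p.2 + ((p.1.2 : ℝ) + y) ∈ B} := by
  have hm : Measurable fun q : ((PointMeasure × ℝ≥0) × ℝ) × ℝ =>
    q.1.2 + ((q.1.1.2 : ℝ) + q.2) := by fun_prop
  exact Kernel.measurable_kernel_prodMk_left
    (κ := finiteCluster.comap (fun p : (PointMeasure × ℝ≥0) × ℝ => p.1.1) (by fun_prop)) (hm hB)

lemma conv_apply {μ ν : Measure ℝ} [SFinite ν] {B : Set ℝ} (hB : MeasurableSet B) :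
    (μ ∗ ν) B = ∫⁻ x, ν {y | x + y ∈ B} ∂μ := by
  rw [Measure.conv, Measure.map_apply (by fun_prop) hB,
    Measure.prod_apply (hB.preimage (by fun_prop))]
  rfl

lemma measurableSet_add_mem {B : Set ℝ} (hB : MeasurableSet B) (y : ℝ) :
    MeasurableSet {u | y + u ∈ B} :=
  hB.preimage (measurable_const_add y)

lemma measurable_measure_add_mem (ν : Measure ℝ) [SFinite ν] {B : Set ℝ} (hB : MeasurableSet B) :
    Measurable fun y => ν {u | y + u ∈ B} :=
  measurable_measure_prodMk_left (s := {p : ℝ × ℝ | p.1 + p.2 ∈ B})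
    (hB.preimage (measurable_fst.add measurable_snd))

/-! ### Mean measure of the renewal cluster process. -/

section Cluster

variable {Ω : Type*} [MeasurableSpace Ω] {P : Measure Ω}

section Single

variable {ξ : Ω → PointMeasure} {X : Ω → ℝ≥0} {S : Ω → ℝ}

/-- Replacing the cluster by an s-finite kernel that almost surely agrees with it provides joint
measurability in the cluster and its translation. -/
lemma map_add_apply_ae_eq (hfin : ∀ᵐ ω ∂P, clusterSize (ξ ω) < ∞) {B : Set ℝ}
    (hB : MeasurableSet B) :
    (fun ω => (ξ ω : Measure ℝ).map (fun y => (S ω + X ω) + y) B) =ᵐ[P]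
      fun ω => finiteCluster (ξ ω) {y | S ω + ((X ω : ℝ) + y) ∈ B} := by
  filter_upwards [hfin] with ω hω
  rw [Measure.map_apply (by fun_prop) hB, finiteCluster_apply hω]
  simp only [add_assoc]
  rfl

lemma aemeasurable_map_add_apply (hξ : Measurable ξ) (hX : Measurable X) (hS : Measurable S)
    (hfin : ∀ᵐ ω ∂P, clusterSize (ξ ω) < ∞) {B : Set ℝ} (hB : MeasurableSet B) :
    AEMeasurable (fun ω => (ξ ω : Measure ℝ).map (fun y => (S ω + X ω) + y) B) P :=
  ⟨_, (measurable_finiteCluster_translate hB).comp ((hξ.prodMk hX).prodMk hS),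
    map_add_apply_ae_eq hfin hB⟩

/-- The translation is split as `S + X` because `X` may depend on the cluster while `S`, the
preceding parent point (or 0 for the initial cluster), does not. Independence then allows
integrating the pair first, with `S` frozen. -/
lemma lintegral_map_add_apply [IsProbabilityMeasure P] (hξ : Measurable ξ) (hX : Measurable X) (hS : Measurable S)
    (hindep : IndepFun (fun ω => (ξ ω, X ω)) S P)
    (hfin : ∀ᵐ ω ∂P, clusterSize (ξ ω) < ∞) {B : Set ℝ} (hB : MeasurableSet B) :
    ∫⁻ ω, (ξ ω : Measure ℝ).map (fun y => (S ω + X ω) + y) B ∂P =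
      ∫⁻ u, clusterIntensity (P.map fun ω => (ξ ω, X ω)) {z | u + z ∈ B} ∂(P.map S) := by
  have hW := hξ.prodMk hX
  have hG := measurable_finiteCluster_translate hB
  rw [lintegral_congr_ae (map_add_apply_ae_eq hfin hB),
    ← lintegral_map (f := fun p : (PointMeasure × ℝ≥0) × ℝ =>
      finiteCluster p.1.1 {y | p.2 + ((p.1.2 : ℝ) + y) ∈ B})
      (g := fun ω => ((ξ ω, X ω), S ω)) hG (hW.prodMk hS),
    (indepFun_iff_map_prod_eq_prod_map_map hW.aemeasurable hS.aemeasurable).1 hindep,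
    lintegral_prod_symm _ hG.aemeasurable]
  refine lintegral_congr fun u => ?_
  rw [clusterIntensity_apply _ (measurableSet_add_mem hB u)]
  rfl

lemma clusterIntensity_univ [IsProbabilityMeasure P] (hξ : Measurable ξ) (hX : Measurable X)
    (hfin : ∀ᵐ ω ∂P, clusterSize (ξ ω) < ∞) :
    clusterIntensity (P.map fun ω => (ξ ω, X ω)) univ = ∫⁻ ω, clusterSize (ξ ω) ∂P := by
  rw [clusterIntensity_apply _ .univ, lintegral_map _ (hξ.prodMk hX)]
  · refine lintegral_congr_ae ?_
    filter_upwards [hfin] with ω hω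
    rw [finiteCluster_apply hω]
    simp [clusterSize]
  · simp only [mem_univ, ofPred_true]
    exact (finiteCluster.measurable_coe .univ).comp measurable_fst

end Single

variable {ξ : ℕ → Ω → PointMeasure} {X : ℕ → Ω → ℝ≥0}

lemma measurable_parentPoint (hX : ∀ i, Measurable (X i)) (i : ℕ) :
    Measurable (parentPoint X i) :=
  Finset.measurable_fun_sum _ fun j _ => (hX j).coe_nnreal_real

lemma indepFun_parentPoint (hξ : ∀ i, Measurable (ξ i)) (hX : ∀ i, Measurable (X i))
    (hindep : iIndepFun (fun (i : ℕ) (ω : Ω) => (ξ i ω, X i ω)) P) (i : ℕ) :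
    IndepFun (fun ω => (ξ (i + 1) ω, X (i + 1) ω)) (parentPoint X i) P := by
  have h := hindep.indepFun_finset {i + 1} (Finset.range (i + 1)) (by simp)
    fun j => (hξ j).prodMk (hX j)
  refine (h.comp
    (φ := fun f : ({i + 1} : Finset ℕ) → PointMeasure × ℝ≥0 => f ⟨i + 1, Finset.mem_singleton_self _⟩)
    (ψ := fun f : Finset.range (i + 1) → PointMeasure × ℝ≥0 => ∑ j, ((f j).2 : ℝ))
    (by fun_prop) (by fun_prop)).congr
    (Eventually.of_forall fun ω => rfl) (Eventually.of_forall fun ω => ?_)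
  exact Finset.sum_coe_sort (Finset.range (i + 1)) fun j => (X j ω : ℝ)

lemma map_parentPoint [IsProbabilityMeasure P] (hξ : ∀ i, Measurable (ξ i)) (hX : ∀ i, Measurable (X i))
    (hindep : iIndepFun (fun (i : ℕ) (ω : Ω) => (ξ i ω, X i ω)) P)
    (hident : ∀ i, 1 ≤ i →
      IdentDistrib (fun ω => (ξ i ω, X i ω)) (fun ω => (ξ 1 ω, X 1 ω)) P P)
    (i : ℕ) : P.map (parentPoint X i) =
      P.map (fun ω => (X 0 ω : ℝ)) ∗ convPow (P.map fun ω => (X 1 ω : ℝ)) i := by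
  have hXr : ∀ i, Measurable fun ω => (X i ω : ℝ) := fun i => (hX i).coe_nnreal_real
  have : IsProbabilityMeasure (P.map fun ω => (X 1 ω : ℝ)) :=
    Measure.isProbabilityMeasure_map (hXr 1).aemeasurable
  induction i with
  | zero =>
    simp only [convPow, Measure.conv_dirac_zero]
    congr 1 with ω
    simp [parentPoint]
  | succ i ih =>
    have h1 : parentPoint X (i + 1) = parentPoint X i + fun ω => (X (i + 1) ω : ℝ) := by
      ext ω
      simp [parentPoint, Finset.sum_range_succ _ (i + 1)]
    have h2 : IndepFun (parentPoint X i) (fun ω => (X (i + 1) ω : ℝ)) P :=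
      ((indepFun_parentPoint hξ hX hindep i).comp (φ := fun w : PointMeasure × ℝ≥0 => (w.2 : ℝ))
        (ψ := id)
        (by fun_prop) measurable_id).symm
    have h3 : P.map (fun ω => (X (i + 1) ω : ℝ)) = P.map fun ω => (X 1 ω : ℝ) :=
      ((hident (i + 1) (by simp)).comp (u := fun w : PointMeasure × ℝ≥0 => (w.2 : ℝ)) (by fun_prop)).map_eq
    rw [h1, h2.map_add_eq_map_conv_map (measurable_parentPoint hX i) (hXr _), ih, h3,
      Measure.conv_assoc, convPow_succ']

/-- The intensity of the renewal cluster process, as that of the initial cluster plus a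
convolution with the renewal measure. -/
lemma lintegral_renewalCluster [IsProbabilityMeasure P] (hξ : ∀ i, Measurable (ξ i)) (hX : ∀ i, Measurable (X i))
    (hindep : iIndepFun (fun (i : ℕ) (ω : Ω) => (ξ i ω, X i ω)) P)
    (hident : ∀ i, 1 ≤ i →
      IdentDistrib (fun ω => (ξ i ω, X i ω)) (fun ω => (ξ 1 ω, X 1 ω)) P P)
    (hfin : ∀ i, ∀ᵐ ω ∂P, clusterSize (ξ i ω) < ∞)
    [IsFiniteMeasure (clusterIntensity (P.map fun ω => (ξ 1 ω, X 1 ω)))]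
    {B : Set ℝ} (hB : MeasurableSet B) :
    ∫⁻ ω, renewalCluster ξ X ω B ∂P = clusterIntensity (P.map fun ω => (ξ 0 ω, X 0 ω)) B +
      ∫⁻ y, renewalMeasure (P.map fun ω => (X 1 ω : ℝ)) {u | y + u ∈ B}
        ∂(clusterIntensity (P.map fun ω => (ξ 1 ω, X 1 ω)) ∗ P.map fun ω => (X 0 ω : ℝ)) := by
  have hXr : ∀ i, Measurable fun ω => (X i ω : ℝ) := fun i => (hX i).coe_nnreal_real
  have hprob : ∀ i, IsProbabilityMeasure (P.map fun ω => (X i ω : ℝ)) := fun i =>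
    Measure.isProbabilityMeasure_map (hXr i).aemeasurable
  set ν := clusterIntensity (P.map fun ω => (ξ 1 ω, X 1 ω)) with hν
  set F := P.map fun ω => (X 1 ω : ℝ) with hF
  set F₀ := P.map fun ω => (X 0 ω : ℝ) with hF₀
  have hzero : ∀ ω, parentPoint X 0 ω = 0 + X 0 ω := fun ω => by simp [parentPoint]
  have hsucc : ∀ i ω, parentPoint X (i + 1) ω = parentPoint X i ω + X (i + 1) ω := fun i ω => by
    simp [parentPoint, Finset.sum_range_succ _ (i + 1)]
  have hmeas : ∀ i, AEMeasurable
      (fun ω => (ξ i ω : Measure ℝ).map (fun y => parentPoint X i ω + y) B) P := by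
    intro i
    cases i with
    | zero =>
      simp only [hzero]
      exact aemeasurable_map_add_apply (hξ 0) (hX 0) measurable_const (hfin 0) hB
    | succ i =>
      simp only [hsucc]
      exact aemeasurable_map_add_apply (hξ _) (hX _) (measurable_parentPoint hX i) (hfin _) hB
  simp only [renewalCluster, Measure.sum_apply _ hB]
  rw [lintegral_tsum hmeas, tsum_eq_zero_add' ENNReal.summable]
  congr 1
  · simp only [hzero]
    rw [lintegral_map_add_apply (hξ 0) (hX 0) measurable_const (indepFun_const_right _ 0) (hfin 0) hB]
    simp [Measure.map_const]
  -- The convolution factors are reordered so that only `convPow F i` depends on `i`; summation over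
  -- `i` then produces the renewal measure.
  · have hterm : ∀ i, ∫⁻ ω, (ξ (i + 1) ω : Measure ℝ).map
        (fun y => parentPoint X (i + 1) ω + y) B ∂P =
        ∫⁻ y, convPow F i {u | y + u ∈ B} ∂(ν ∗ F₀) := by
      intro i
      simp only [hsucc]
      rw [lintegral_map_add_apply (hξ _) (hX _) (measurable_parentPoint hX i)
        (indepFun_parentPoint hξ hX hindep i) (hfin _) hB, (hident (i + 1) (by simp)).map_eq,
        map_parentPoint hξ hX hindep hident, ← hν, ← conv_apply hB, ← conv_apply hB,
        Measure.conv_comm, Measure.conv_assoc]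
    simp only [hterm]
    rw [← lintegral_tsum]
    · refine lintegral_congr fun y => ?_
      rw [renewalMeasure, Measure.sum_apply _ (measurableSet_add_mem hB y)]
    · intro i
      exact (measurable_measure_add_mem _ hB).aemeasurable

end Cluster

/-! ### Passage to the limit. -/

lemma tendsto_measure_Ioc_atTop (ν : Measure ℝ) [IsFiniteMeasure ν] (x : ℝ) :
    Tendsto (fun t => ν (Ioc t (t + x))) atTop (𝓝 0) := by
  have h : Tendsto (fun t => ν (Ioi t)) atTop (𝓝 0) := by
    have := tendsto_measure_iInter_atTop (μ := ν) (s := fun t : ℝ => Ioi t)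
      (fun t => measurableSet_Ioi.nullMeasurableSet) (fun a b h => Ioi_subset_Ioi h)
      ⟨0, measure_ne_top _ _⟩
    have he : ⋂ t : ℝ, Ioi t = ∅ := by
      ext y
      simp only [mem_iInter, mem_Ioi, mem_empty_iff_false, iff_false, not_forall]
      exact ⟨y, lt_irrefl y⟩
    rwa [he, measure_empty] at this
  exact tendsto_of_tendsto_of_tendsto_of_le_of_le tendsto_const_nhds h (fun _ => zero_le)
    fun t => measure_mono Ioc_subset_Ioi_self

/-- Blackwell's renewal theorem for the convolution of the renewal measure with a finite
measure. -/
lemma tendsto_lintegral_renewalMeasure_Ioc {F : Measure ℝ} [IsProbabilityMeasure F]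
    (hF : IsNonarithmetic F) (hF0 : F (Iio 0) = 0)
    (hpos : ∫⁻ y, ENNReal.ofReal y ∂F ≠ 0) (hfin : ∫⁻ y, ENNReal.ofReal y ∂F ≠ ∞)
    (ν : Measure ℝ) [IsFiniteMeasure ν] {x : ℝ} (hx : 0 < x) :
    Tendsto (fun t => ∫⁻ y, renewalMeasure F {u | y + u ∈ Ioc t (t + x)} ∂ν) atTop
      (𝓝 (ν univ / (∫⁻ y, ENNReal.ofReal y ∂F) * ENNReal.ofReal x)) := by
  set m := ∫⁻ y, ENNReal.ofReal y ∂F with hm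
  have hm0 : 0 < m.toReal := ENNReal.toReal_pos hpos hfin
  obtain ⟨C, hC⟩ := exists_renewalMeasure_Icc_le hF hF0 x
  have hset : ∀ t y : ℝ, {u | y + u ∈ Ioc t (t + x)} = Ioc (t - y) (t - y + x) := by
    intro t y
    ext u
    simp only [mem_ofPred_eq, mem_Ioc]
    constructor <;> rintro ⟨h1, h2⟩ <;> constructor <;> linarith
  have hle : ∀ t, renewalMeasure F (Ioc t (t + x)) ≤ C := fun t =>
    (measure_mono Ioc_subset_Icc_self).trans (hC t)
  have hlim : Tendsto (fun t => renewalMeasure F (Ioc t (t + x))) atTop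
      (𝓝 (ENNReal.ofReal (x / m.toReal))) := by
    refine (ENNReal.tendsto_ofReal (tendsto_renewalMeasure_Ioc hF hF0 hpos hfin hx)).congr
      fun t => ?_
    exact ofReal_measureReal ((hle t).trans_lt ENNReal.coe_lt_top).ne
  have hval : ν univ / m * ENNReal.ofReal x = ∫⁻ _, ENNReal.ofReal (x / m.toReal) ∂ν := by
    rw [lintegral_const, ENNReal.ofReal_div_of_pos hm0, ENNReal.ofReal_toReal hfin,
      div_eq_mul_inv, div_eq_mul_inv]
    ring
  rw [hval]
  -- For fixed `y` the window is merely moved to start at `t - y`, so Blackwell's theorem gives the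
  -- pointwise limit; `C` bounds the renewal mass of all windows of length `x` and is integrable for
  -- the finite `ν`.
  refine tendsto_lintegral_filter_of_dominated_convergence (fun _ => (C : ℝ≥0∞))
    (Eventually.of_forall fun t => ?_) (Eventually.of_forall fun t => Eventually.of_forall fun y => ?_)
    (by simp [lintegral_const, ENNReal.mul_eq_top]) (Eventually.of_forall fun y => ?_)
  · exact measurable_measure_add_mem _ measurableSet_Ioc
  · rw [hset]
    exact hle _
  · simp only [hset]
    exact hlim.comp (tendsto_atTop_add_const_right _ (-y) tendsto_id)

theorem corollary3 {Ω : Type*} [MeasurableSpace Ω] (P : Measure Ω) [IsProbabilityMeasure P]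
    -- the pairs `W'_i = (ξ'_i, X'_i)`, `i ≥ 0`, are random elements of `M_p(ℝ) × ℝ₊`
    (ξ : ℕ → Ω → PointMeasure) (X : ℕ → Ω → ℝ≥0)
    (hξ : ∀ i, Measurable (ξ i)) (hX : ∀ i, Measurable (X i))
    -- they are independent, and those with `i ≥ 1` are identically distributed
    (hindep : iIndepFun (fun (i : ℕ) (ω : Ω) => (ξ i ω, X i ω)) P)
    (hident : ∀ i, 1 ≤ i →
      IdentDistrib (fun ω => (ξ i ω, X i ω)) (fun ω => (ξ 1 ω, X 1 ω)) P P)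
    -- the steps `X'_i`, `i ≥ 1`, have a nonarithmetic law with mean `μ ∈ (0, ∞)`
    (hnonarith : IsNonarithmetic (P.map fun ω => (X 1 ω : ℝ)))
    (μ : ℝ≥0∞) (hμ : μ = ∫⁻ ω, (X 1 ω : ℝ≥0∞) ∂P) (hμ_pos : 0 < μ) (hμ_fin : μ < ∞)
    -- every cluster is a.s. finite, and a.s. `ξ'` is finite on bounded sets
    (hfin : ∀ i, ∀ᵐ ω ∂P, clusterSize (ξ i ω) < ∞)
    (hlocfin : ∀ᵐ ω ∂P, ∀ B : Set ℝ, MeasurableSet B → Bornology.IsBounded B →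
      renewalCluster ξ X ω B < ∞)
    -- `L'_0`, `L'_1`, `L'_1 X'_1` and `L'_1 R'_1` have finite mean
    (hL0 : ∫⁻ ω, clusterSize (ξ 0 ω) ∂P < ∞)
    (hL1 : ∫⁻ ω, clusterSize (ξ 1 ω) ∂P < ∞)
    (hLX : ∫⁻ ω, clusterSize (ξ 1 ω) * (X 1 ω : ℝ≥0∞) ∂P < ∞)
    (hLR : ∫⁻ ω, clusterSize (ξ 1 ω) * clusterRadius (ξ 1 ω) ∂P < ∞)
    (x : ℝ) (hx : 0 < x) :
    Tendsto (fun t : ℝ => ∫⁻ ω, renewalCluster ξ X ω (Ioc t (t + x)) ∂P) atTop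
      (𝓝 ((∫⁻ ω, clusterSize (ξ 1 ω) ∂P) / μ * ENNReal.ofReal x)) := by
  have hXr : ∀ i, Measurable fun ω => (X i ω : ℝ) := fun i => (hX i).coe_nnreal_real
  have hprob : ∀ i, IsProbabilityMeasure (P.map fun ω => (X i ω : ℝ)) := fun i =>
    Measure.isProbabilityMeasure_map (hXr i).aemeasurable
  have huniv : ∀ i, clusterIntensity (P.map fun ω => (ξ i ω, X i ω)) univ =
      ∫⁻ ω, clusterSize (ξ i ω) ∂P := fun i => clusterIntensity_univ (hξ i) (hX i) (hfin i)
  have hfin₀ : IsFiniteMeasure (clusterIntensity (P.map fun ω => (ξ 0 ω, X 0 ω))) :=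
    ⟨by rwa [huniv]⟩
  have hfin₁ : IsFiniteMeasure (clusterIntensity (P.map fun ω => (ξ 1 ω, X 1 ω))) :=
    ⟨by rwa [huniv]⟩
  have hmean : ∫⁻ y, ENNReal.ofReal y ∂(P.map fun ω => (X 1 ω : ℝ)) = μ := by
    rw [lintegral_map ENNReal.measurable_ofReal (hXr 1), hμ]
    simp only [ENNReal.ofReal_coe_nnreal]
  have hnonneg : (P.map fun ω => (X 1 ω : ℝ)) (Iio 0) = 0 := by
    rw [Measure.map_apply (hXr 1) measurableSet_Iio]
    simp [preimage, not_lt.2 (NNReal.coe_nonneg _)]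
  have hlim := (tendsto_measure_Ioc_atTop (clusterIntensity (P.map fun ω => (ξ 0 ω, X 0 ω)))
    x).add (tendsto_lintegral_renewalMeasure_Ioc hnonarith hnonneg
      (by rw [hmean]; exact hμ_pos.ne') (by rw [hmean]; exact hμ_fin.ne)
      (clusterIntensity (P.map fun ω => (ξ 1 ω, X 1 ω)) ∗ P.map fun ω => (X 0 ω : ℝ)) hx)
  -- Convolution with the probability law of `X 0` keeps the total mass, so the delay has no
  -- influence on the limit.
  have hmass : (clusterIntensity (P.map fun ω => (ξ 1 ω, X 1 ω)) ∗
      P.map fun ω => (X 0 ω : ℝ)) univ = ∫⁻ ω, clusterSize (ξ 1 ω) ∂P := by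
    rw [conv_apply .univ]
    simp [huniv]
  rw [zero_add, hmass, hmean] at hlim
  exact hlim.congr fun t =>
    (lintegral_renewalCluster hξ hX hindep hident hfin measurableSet_Ioc).symm
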